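/- Let $E$ be a real topological vector space whose topology is separable and completely metrizable. Assume that the continuous linear functionals separate the points of $E$ and that $E$ is strongly root compact: for every compact $C\subset E$ there is a compact $C_0\subset E$ such that for every $n\ge 1$, every finite sequence $x_1,\dots,x_n\in E$ with $x_n=0$ and $(C+x_i+C+x_j)\cap(C+x_{i+j})\neq\emptyset$ for all $i,j\ge1$ with $i+j\le n$ is contained in $C_0$. Let $\mathcal P(E)$ be the set of Borel probability measures on $E$ with the weak topology, write products for convolutions, let $\delta_x$ be the point mass at $x$, and let $T(\mu)$ denote the image of $\mu$ under $T$. Let $\mathcal L_+$ be the set of all homomorphisms $t\mapsto T_t$ from the multiplicative group $(0,\infty)$ to the group of invertible continuous linear operators on $E$ that are continuous in the strong operator topology and satisfy $T_t(x)\to 0$ as $t\to0$ for all $x\in E$. A triangular system $\{\lambda_{n,j}: n\ge 1,\ 1\le j\le k_n\}$ in $\mathcal P(E)$ is infinitesimal if $\sup_{j}\lambda_{n,j}(E\setminus U)\to0$ as $n\to\infty$ for every open neighbourhood $U$ of $0$. Let $(T_t)\in\mathcal L_+$. - $\mu\in\mathcal P(E)$ is *operator selfdecomposable* with respect to $(T_t)$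 if there are sequences $(\mu_n)$ in $\mathcal P(E)$, $(x_n)$ in $E$ and $b_n>0$ such that $\{T_{1/b_n}(\mu_i): 1\le i\le n\}$ is infinitesimal and $T_{1/b_n}(\mu_1\cdots\mu_n)\,\delta_{x_n}\to\mu$. - For $0<b<1$, $\tilde L_0(b,(T_t))$ is the set of all $\mu\in\mathcal P(E)$ for which there are sequences $(\mu_n)$ in $\mathcal P(E)$, $(x_n)$ in $E$, $a_n>0$ and a strictly increasing sequence $(k_n)$ of positive integers with $a_n/a_{n+1}\to b$ and $T_{1/a_n}(\mu_1\cdots\mu_{k_n})\,\delta_{x_n}\to\mu$. The class $L_0(b,(T_t))$ is defined in the same way, with the additional requirement that $\{T_{1/a_n}(\mu_i):1\le i\le k_n\}$ is infinitesimal. - $L_0([0,1],(T_t))=\bigcap_{0<b<1}L_0(b,(T_t))$ and $\tilde L_0([0,1],(T_t))=\bigcap_{0<b<1}\tilde L_0(b,(T_t))$. **Theorem.** Let $(T_t)\in\mathcal L_+$ and $\mu\in\mathcal P(E)$. The following are equivalent: 1. $\mu$ is operator selfdecomposable with respect to $(T_t)$; 2. $\mu\in L_0([0,1],(T_t))$;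 3. $\mu\in\tilde L_0([0,1],(T_t))$; 4. $\mu\in L_0(b,(T_t))$ for every $0<b<1$. -/

import Mathlib

open Filter Topology MeasureTheory Set
open scoped Pointwise

namespace OpSelfDec

/-- The multiplicative group of positive real numbers. -/
abbrev PosReal : Type := {t : ℝ // 0 < t}

/-- An additive topological group is strongly root compact if for every compact `C` there is a
compact `C₀` containing every finite sequence `x 1, …, x n` with `x n = 0` such that
`C + x i + C + x j` meets `C + x (i + j)` whenever `i, j ≥ 1` and `i + j ≤ n`. -/
def StronglyRootCompact (E : Type*) [TopologicalSpace E] [AddCommGroup E] : Prop :=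
  ∀ C : Set E, IsCompact C → ∃ C₀ : Set E, IsCompact C₀ ∧
    ∀ n : ℕ, 1 ≤ n → ∀ x : ℕ → E, x n = 0 →
      (∀ i j : ℕ, 1 ≤ i → 1 ≤ j → i + j ≤ n →
        ((C + {x i} + C + {x j}) ∩ (C + {x (i + j)})).Nonempty) →
      ∀ i : ℕ, 1 ≤ i → i ≤ n → x i ∈ C₀

section

variable {E : Type*} [AddCommGroup E] [Module ℝ E] [TopologicalSpace E]

/-- The family `(T t)`, `t > 0`, is in `𝓛₊`: it is a homomorphism from the multiplicative group
`(0, ∞)` to the invertible continuous linear operators, continuous for the strong operator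
topology, with `T t x → 0` as `t → 0` for each `x`. -/
structure InLPlus (T : PosReal →* (E ≃L[ℝ] E)) : Prop where
  continuous_apply : ∀ x : E, Continuous fun t : PosReal => T t x
  tendsto_zero : ∀ x : E,
    Tendsto (fun t : PosReal => T t x) (comap (fun t : PosReal => (t : ℝ)) (𝓝 0)) (𝓝 0)

variable [IsTopologicalAddGroup E] [PolishSpace E] [MeasurableSpace E] [BorelSpace E]

/-- The image `S(μ)`. -/
noncomputable def opMap (S : E ≃L[ℝ] E) (μ : ProbabilityMeasure E) : ProbabilityMeasure E :=
  μ.map S.continuous.measurable.aemeasurable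

/-- The convolution of two probability measures. -/
noncomputable def conv (μ ν : ProbabilityMeasure E) : ProbabilityMeasure E :=
  ⟨(μ : Measure E).conv (ν : Measure E), inferInstance⟩

/-- The point mass at `x`. -/
noncomputable def pointMass (x : E) : ProbabilityMeasure E :=
  ⟨Measure.dirac x, inferInstance⟩

/-- The convolution `μ 0 * μ 1 * ⋯ * μ (n - 1)` of the first `n` terms of a sequence
(the point mass at `0` if `n = 0`). -/
noncomputable def convProd (μ : ℕ → ProbabilityMeasure E) : ℕ → ProbabilityMeasure E
  | 0 => pointMass 0
  | n + 1 => conv (convProd μ n) (μ n)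

/-- The triangular system `lam n j`, `j < k n`, is infinitesimal:
`sup_j lam n j (E \ U) → 0` as `n → ∞` for each open neighbourhood `U` of `0`. -/
def Infinitesimal (k : ℕ → ℕ) (lam : ℕ → ℕ → ProbabilityMeasure E) : Prop :=
  ∀ U : Set E, IsOpen U → (0 : E) ∈ U →
    Tendsto (fun n => ⨆ j ∈ Finset.range (k n), (lam n j : Measure E) Uᶜ) atTop (𝓝 0)

/-- The class `K̃(H, b, (T t))`. -/
def KTilde (H : Set (ProbabilityMeasure E)) (b : ℝ) (T : PosReal →* (E ≃L[ℝ] E)) :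
    Set (ProbabilityMeasure E) :=
  {μ | ∃ (m : ℕ → ProbabilityMeasure E) (a : ℕ → PosReal) (k : ℕ → ℕ) (x : ℕ → E),
    (∀ i, m i ∈ H) ∧ StrictMono k ∧
    Tendsto (fun n => (a n : ℝ) / (a (n + 1) : ℝ)) atTop (𝓝 b) ∧
    Tendsto (fun n => conv (opMap (T (a n)⁻¹) (convProd m (k n))) (pointMass (x n)))
      atTop (𝓝 μ)}

/-- The class `K(H, b, (T t))`: as `K̃(H, b, (T t))`, with the additional requirement that the
triangular system `T_{1 / a n} (m i)`, `i < k n`, is infinitesimal. -/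
def K (H : Set (ProbabilityMeasure E)) (b : ℝ) (T : PosReal →* (E ≃L[ℝ] E)) :
    Set (ProbabilityMeasure E) :=
  {μ | ∃ (m : ℕ → ProbabilityMeasure E) (a : ℕ → PosReal) (k : ℕ → ℕ) (x : ℕ → E),
    (∀ i, m i ∈ H) ∧ StrictMono k ∧
    Tendsto (fun n => (a n : ℝ) / (a (n + 1) : ℝ)) atTop (𝓝 b) ∧
    Tendsto (fun n => conv (opMap (T (a n)⁻¹) (convProd m (k n))) (pointMass (x n)))
      atTop (𝓝 μ) ∧
    Infinitesimal k (fun n i => opMap (T (a n)⁻¹) (m i))}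

/-- The class `K(H, [0,1], (T t))`, the intersection of the classes `K(H, b, (T t))` over
`b ∈ [0,1] \ {0,1}`. -/
def KUnit (H : Set (ProbabilityMeasure E)) (T : PosReal →* (E ≃L[ℝ] E)) :
    Set (ProbabilityMeasure E) :=
  ⋂ b ∈ Icc (0 : ℝ) 1 \ {0, 1}, K H b T

/-- The class `K̃(H, [0,1], (T t))`. -/
def KTildeUnit (H : Set (ProbabilityMeasure E)) (T : PosReal →* (E ≃L[ℝ] E)) :
    Set (ProbabilityMeasure E) :=
  ⋂ b ∈ Icc (0 : ℝ) 1 \ {0, 1}, KTilde H b T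

/-- The class `L₀(b, (T t))`. -/
def L0 (b : ℝ) (T : PosReal →* (E ≃L[ℝ] E)) : Set (ProbabilityMeasure E) :=
  K Set.univ b T

/-- The class `L₀([0,1], (T t))`. -/
def L0Unit (T : PosReal →* (E ≃L[ℝ] E)) : Set (ProbabilityMeasure E) :=
  KUnit Set.univ T

/-- The class `L̃₀([0,1], (T t))`. -/
def L0TildeUnit (T : PosReal →* (E ≃L[ℝ] E)) : Set (ProbabilityMeasure E) :=
  KTildeUnit Set.univ T

/-- `μ` is operator selfdecomposable with respect to `(T t)`. -/
def OperatorSelfdecomposable (T : PosReal →* (E ≃L[ℝ] E)) (μ : ProbabilityMeasure E) : Prop :=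
  ∃ (m : ℕ → ProbabilityMeasure E) (x : ℕ → E) (b : ℕ → PosReal),
    Infinitesimal (fun n => n) (fun n i => opMap (T (b n)⁻¹) (m i)) ∧
    Tendsto (fun n => conv (opMap (T (b n)⁻¹) (convProd m n)) (pointMass (x n))) atTop (𝓝 μ)

end

end OpSelfDec

/-!
The limit theorems are compared through the intrinsic property that `T c (μ)` divides `μ` in the
convolution semigroup for every `0 < c < 1`.

Suppose `T (1 / b n) (m 0 * ⋯ * m (n - 1))`, suitably centred, converges to `μ`. If `c` is a limit
of quotients `b (N n) / b n` with `N n ≤ n`, then `T c (μ)` is a limit of factors of measures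
converging to `μ`, and by tightness the cofactors converge along a subsequence. For an infinitesimal
system every `c` is such a limit: unless the symmetrization `π` of `μ` is the point mass at `0`, no
`T r` with `r < 1` fixes `π`, which forces `b n / b (n + 1) → 1` and `b n → ∞`.

Conversely, let `ν n` be a cofactor of `T (n / (n + 1)) (μ)` in `μ`. The products of the measures
`T (n + 1) (ν n)` telescope to the measures `T n (μ)`, and infinitesimality amounts to `ν n → δ₀`
since the operators `T t`, `t ≤ 1`, are equicontinuous by Banach–Steinhaus. A limit point `ν` of
`(ν n)` satisfies `μ * ν = μ`, so by Choquet–Deny `μ` is invariant under translation by each `y` in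
the support of `ν`. The multiples of such a `y` then form a tight sequence, whence `y = 0`.
-/

open scoped NNReal BoundedContinuousFunction

namespace OpSelfDec

section UniformBoundedness

variable {𝕜 E F X : Type*} [NontriviallyNormedField 𝕜]
  [AddCommGroup E] [Module 𝕜 E] [TopologicalSpace E] [IsTopologicalAddGroup E]
  [ContinuousConstSMul 𝕜 E] [BaireSpace E]
  [AddCommGroup F] [Module 𝕜 F] [TopologicalSpace F] [IsTopologicalAddGroup F]

theorem exists_nhds_zero_forall_mapsTo_of_isVonNBounded [ContinuousConstSMul 𝕜 F] {ι : Type*}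
    {A : ι → E →L[𝕜] F} (hA : ∀ x, Bornology.IsVonNBounded 𝕜 (range fun i => A i x))
    {U : Set F} (hU : U ∈ 𝓝 0) : ∃ V ∈ 𝓝 (0 : E), ∀ i, MapsTo (A i) V U := by
  obtain ⟨W₀, hW₀, hW₀U⟩ := exists_nhds_half_neg hU
  obtain ⟨W, hW, hWc, hWW₀⟩ := exists_mem_nhds_isClosed_subset hW₀
  obtain ⟨c, hc⟩ := NormedField.exists_one_lt_norm 𝕜
  have hck (k : ℕ) : c ^ k ≠ 0 := pow_ne_zero k (norm_pos_iff.1 (one_pos.trans hc))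
  let S (k : ℕ) : Set E := ⋂ i, A i ⁻¹' (c ^ k • W)
  have hS_closed (k : ℕ) : IsClosed (S k) :=
    isClosed_iInter fun i => (hWc.smul_of_ne_zero (hck k)).preimage (A i).continuous
  have hS_cover : ⋃ k, S k = univ := by
    refine eq_univ_of_forall fun x => ?_
    have hpow : Tendsto (c ^ · : ℕ → 𝕜) atTop (Bornology.cobounded 𝕜) := by
      simpa only [← tendsto_norm_atTop_iff_cobounded, norm_pow] using
        tendsto_pow_atTop_atTop_of_one_lt hc
    obtain ⟨k, hk⟩ := (hpow.eventually (hA x hW)).exists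
    exact mem_iUnion.2 ⟨k, mem_iInter.2 fun i => hk (mem_range_self i)⟩
  obtain ⟨k, x₀, hx₀⟩ := nonempty_interior_of_iUnion_of_closed hS_closed hS_cover
  have hshift : Continuous fun w : E => x₀ + c ^ k • w := by fun_prop
  refine ⟨{w | x₀ + c ^ k • w ∈ S k},
    hshift.continuousAt.preimage_mem_nhds (by simpa using mem_interior_iff_mem_nhds.1 hx₀),
    fun i w hw => ?_⟩
  obtain ⟨v, hv, hv_eq⟩ := mem_iInter.1 hw i
  obtain ⟨v₀, hv₀, hv₀_eq⟩ := mem_iInter.1 (interior_subset hx₀) i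
  have hAw : A i w = v - v₀ := smul_right_injective F (hck k) <| by
    simp only at hv_eq hv₀_eq ⊢
    rw [smul_sub, hv_eq, hv₀_eq, map_add, map_smul, add_sub_cancel_left]
  exact hAw ▸ hW₀U v (hWW₀ hv) v₀ (hWW₀ hv₀)

variable [TopologicalSpace X] [ContinuousSMul 𝕜 F] {A : X → E →L[𝕜] F}

theorem exists_nhds_zero_forall_mem_mapsTo_of_isCompact (hA : ∀ x, Continuous fun t => A t x)
    {s : Set X} (hs : IsCompact s) {U : Set F} (hU : U ∈ 𝓝 0) :
    ∃ V ∈ 𝓝 (0 : E), ∀ t ∈ s, MapsTo (A t) V U := by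
  have hbdd (x : E) : Bornology.IsVonNBounded 𝕜 (range fun t : s => A t x) := by
    simpa only [image_eq_range] using (hs.image (hA x)).isVonNBounded 𝕜
  simpa only [Subtype.forall] using exists_nhds_zero_forall_mapsTo_of_isVonNBounded hbdd hU

theorem continuous_uncurry_clm_of_continuous_apply [WeaklyLocallyCompactSpace X]
    (hA : ∀ x, Continuous fun t => A t x) : Continuous fun p : X × E => A p.1 p.2 := by
  refine continuous_iff_continuousAt.2 fun ⟨t, x⟩ => ?_
  have hdiff : Tendsto (fun p : X × E => A p.1 (p.2 - x)) (𝓝 (t, x)) (𝓝 0) := by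
    intro U hU
    obtain ⟨s, hs, hst⟩ := exists_compact_mem_nhds t
    obtain ⟨V, hV, hVU⟩ := exists_nhds_zero_forall_mem_mapsTo_of_isCompact hA hs hU
    have hsub : ContinuousAt (fun p : X × E => p.2 - x) (t, x) := by fun_prop
    rw [Filter.mem_map]
    filter_upwards [continuousAt_fst.preimage_mem_nhds hst,
      hsub.preimage_mem_nhds (by simpa using hV)] with p hp₁ hp₂ using hVU p.1 hp₁ hp₂
  have hsplit := hdiff.add (((hA x).comp continuous_fst).tendsto (t, x))
  simpa only [ContinuousAt, Function.comp_apply, ← map_add, sub_add_cancel, zero_add] using hsplit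

end UniformBoundedness

section Dilation

variable {E : Type*} [AddCommGroup E] [Module ℝ E] [TopologicalSpace E]

/-- The homomorphism `t ↦ T t` extended to `[0, ∞)` by the zero operator at `t = 0`. As a
homomorphism of monoids with zero it is subject to all the algebraic laws without any positivity
condition on the parameter. -/
noncomputable def dilation (T : PosReal →* (E ≃L[ℝ] E)) : ℝ≥0 →*₀ (E →L[ℝ] E) where
  toFun t := if ht : 0 < t then T ⟨t, NNReal.coe_pos.2 ht⟩ else 0
  map_zero' := dif_neg (lt_irrefl 0)
  map_one' := by
    rw [dif_pos one_pos]
    exact congrArg _ (map_one T)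
  map_mul' s t := by
    rcases eq_zero_or_pos s with rfl | hs
    · simp
    rcases eq_zero_or_pos t with rfl | ht
    · simp
    rw [dif_pos hs, dif_pos ht, dif_pos (mul_pos hs ht)]
    exact congrArg _ (map_mul T ⟨s, hs⟩ ⟨t, ht⟩)

variable {T : PosReal →* (E ≃L[ℝ] E)}

theorem dilation_of_pos {t : ℝ≥0} (ht : 0 < t) :
    dilation T t = T ⟨t, NNReal.coe_pos.2 ht⟩ :=
  dif_pos ht

theorem InLPlus.continuous_dilation (hT : InLPlus T) (x : E) :
    Continuous fun t => dilation T t x := by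
  refine continuous_iff_continuousAt.2 fun t => ?_
  rcases eq_zero_or_pos t with rfl | ht
  · rw [ContinuousAt, map_zero, zero_apply]
    intro U hU
    obtain ⟨V, hV, hVU⟩ := mem_comap.1 (hT.tendsto_zero x hU)
    rw [Filter.mem_map]
    filter_upwards [NNReal.continuous_coe.continuousAt.preimage_mem_nhds hV] with s hs
    rcases eq_zero_or_pos s with rfl | hs₀
    · simpa using mem_of_mem_nhds hU
    · rw [mem_preimage, dilation_of_pos hs₀]
      exact hVU (a := ⟨s, hs₀⟩) hs
  · have hpos : ContinuousOn (fun t => dilation T t x) (Ioi 0) := by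
      rw [continuousOn_iff_continuous_domRestrict]
      have hcoe : Continuous fun t : Ioi (0 : ℝ≥0) => (⟨t, t.2⟩ : PosReal) := by fun_prop
      refine ((hT.continuous_apply x).comp hcoe).congr fun t => ?_
      rw [domRestrict_apply, dilation_of_pos t.2]
      rfl
    exact hpos.continuousAt (Ioi_mem_nhds ht)

end Dilation

section PointMass

variable {X : Type*} [MeasurableSpace X]

theorem eq_pointMass_of_ae_eq [MeasurableSingletonClass X] {μ : ProbabilityMeasure X} {x : X}
    (h : ∀ᵐ y ∂(μ : Measure X), y = x) : μ = pointMass x := by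
  have hlaw := (ProbabilityTheory.hasLaw_dirac_iff (X := id)).2 h
  exact Subtype.ext (Measure.map_id.symm.trans hlaw.map_eq)

theorem pointMass_injective [MeasurableSpace.SeparatesPoints X] :
    Function.Injective (pointMass (E := X)) :=
  injective_diracProba

variable [TopologicalSpace X] [OpensMeasurableSpace X]

theorem continuous_pointMass : Continuous (pointMass (E := X)) :=
  continuous_diracProba

theorem tendsto_pointMass_iff [HasOuterApproxClosed X] {ι : Type*} {l : Filter ι}
    [l.IsCountablyGenerated] {a : ι → ProbabilityMeasure X} {x : X} :
    Tendsto a l (𝓝 (pointMass x)) ↔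
      ∀ U : Set X, IsOpen U → x ∈ U → Tendsto (fun i => (a i : Measure X) Uᶜ) l (𝓝 0) := by
  rcases l.eq_or_neBot with rfl | hl
  · simp
  refine ⟨fun h U hU hx => ?_, fun h => tendsto_of_forall_isClosed_limsup_le' fun F hF => ?_⟩
  · have hlimsup := ProbabilityMeasure.limsup_measure_closed_le_of_tendsto h hU.isClosed_compl
    have hzero : (pointMass x : Measure X) Uᶜ = 0 :=
      (Measure.dirac_apply' x hU.measurableSet.compl).trans (indicator_of_notMem (by simpa) _)
    exact tendsto_of_le_liminf_of_limsup_le zero_le (hlimsup.trans_eq hzero)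
  · by_cases hx : x ∈ F
    · have hone : (pointMass x : Measure X) F = 1 :=
        (Measure.dirac_apply' x hF.measurableSet).trans (indicator_of_mem hx _)
      exact hone ▸ limsup_le_of_le (by isBoundedDefault) (.of_forall fun i => prob_le_one)
    · have hzero := (h Fᶜ hF.isOpen_compl hx).limsup_eq
      rw [compl_compl] at hzero
      exact hzero.trans_le zero_le

end PointMass

section Convolution

variable {E : Type*} [AddCommGroup E] [TopologicalSpace E]
  [IsTopologicalAddGroup E] [PolishSpace E] [MeasurableSpace E] [BorelSpace E]

theorem conv_comm (μ ν : ProbabilityMeasure E) : conv μ ν = conv ν μ :=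
  Subtype.ext (Measure.conv_comm _ _)

theorem conv_assoc (μ ν ρ : ProbabilityMeasure E) : conv (conv μ ν) ρ = conv μ (conv ν ρ) :=
  Subtype.ext (Measure.conv_assoc _ _ _)

instance : Std.Commutative (conv (E := E)) := ⟨conv_comm⟩

instance : Std.Associative (conv (E := E)) := ⟨conv_assoc⟩

@[simp]
theorem conv_pointMass_zero (μ : ProbabilityMeasure E) : conv μ (pointMass 0) = μ :=
  Subtype.ext (Measure.conv_dirac_zero _)

@[simp]
theorem pointMass_zero_conv (μ : ProbabilityMeasure E) : conv (pointMass 0) μ = μ :=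
  Subtype.ext (Measure.dirac_zero_conv _)

theorem pointMass_conv_pointMass (x y : E) :
    conv (pointMass x) (pointMass y) = pointMass (x + y) :=
  Subtype.ext (Measure.dirac_conv_dirac _ _)

theorem continuous_conv :
    Continuous fun p : ProbabilityMeasure E × ProbabilityMeasure E => conv p.1 p.2 :=
  (ProbabilityMeasure.continuous_map continuous_add).comp ProbabilityMeasure.continuous_prod

theorem tendsto_conv {ι : Type*} {l : Filter ι} {a b : ι → ProbabilityMeasure E}
    {α β : ProbabilityMeasure E} (ha : Tendsto a l (𝓝 α)) (hb : Tendsto b l (𝓝 β)) :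
    Tendsto (fun i => conv (a i) (b i)) l (𝓝 (conv α β)) :=
  (continuous_conv.tendsto (α, β)).comp (ha.prodMk_nhds hb)

theorem convProd_pointMass_zero (n : ℕ) :
    convProd (fun _ => pointMass (0 : E)) n = pointMass 0 := by
  induction n with
  | zero => rfl
  | succ n ih => rw [convProd, ih, conv_pointMass_zero]

theorem exists_eq_pointMass_of_conv_eq_pointMass {μ ν : ProbabilityMeasure E} {z : E}
    (h : conv μ ν = pointMass z) : ∃ x, μ = pointMass x := by
  have hsum : ∀ᵐ w ∂(conv ν μ : Measure E), w = z := by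
    rw [conv_comm, h]
    exact (ae_dirac_iff (measurableSet_singleton z)).2 rfl
  obtain ⟨y, hy⟩ :=
    (Measure.ae_ae_of_ae_prod (ae_of_ae_map measurable_add.aemeasurable hsum)).exists
  refine ⟨z - y, eq_pointMass_of_ae_eq ?_⟩
  filter_upwards [hy] with x hx using eq_sub_of_add_eq' hx

end Convolution

section MapCLM

variable {E F G X : Type*}
  [AddCommGroup E] [Module ℝ E] [TopologicalSpace E] [MeasurableSpace E] [BorelSpace E]
  [AddCommGroup F] [Module ℝ F] [TopologicalSpace F] [MeasurableSpace F] [BorelSpace F]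
  [AddCommGroup G] [Module ℝ G] [TopologicalSpace G] [MeasurableSpace G] [BorelSpace G]

/-- The image of a probability measure under a continuous linear operator. Unlike `opMap`, this
allows non-invertible operators, such as the value at `0` of `dilation`. -/
noncomputable def mapCLM (A : E →L[ℝ] F) (μ : ProbabilityMeasure E) : ProbabilityMeasure F :=
  μ.map A.continuous.measurable.aemeasurable

theorem mapCLM_comp (B : F →L[ℝ] G) (A : E →L[ℝ] F) (μ : ProbabilityMeasure E) :
    mapCLM (B.comp A) μ = mapCLM B (mapCLM A μ) :=
  Subtype.ext (Measure.map_map B.continuous.measurable A.continuous.measurable).symm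

theorem mapCLM_mul (A B : E →L[ℝ] E) (μ : ProbabilityMeasure E) :
    mapCLM (A * B) μ = mapCLM A (mapCLM B μ) :=
  mapCLM_comp A B μ

@[simp]
theorem mapCLM_one (μ : ProbabilityMeasure E) : mapCLM 1 μ = μ :=
  Subtype.ext Measure.map_id

@[simp]
theorem mapCLM_zero (μ : ProbabilityMeasure E) :
    mapCLM (0 : E →L[ℝ] F) μ = pointMass 0 := by
  refine Subtype.ext ((Measure.map_const (μ : Measure E) 0).trans ?_)
  rw [measure_univ, one_smul]
  rfl

@[simp]
theorem mapCLM_pointMass (A : E →L[ℝ] F) (x : E) :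
    mapCLM A (pointMass x) = pointMass (A x) :=
  Subtype.ext (Measure.map_dirac' A.continuous.measurable x)

theorem mapCLM_conv [IsTopologicalAddGroup E] [PolishSpace E] [IsTopologicalAddGroup F]
    [PolishSpace F] (A : E →L[ℝ] F) (μ ν : ProbabilityMeasure E) :
    mapCLM A (conv μ ν) = conv (mapCLM A μ) (mapCLM A ν) :=
  Subtype.ext (Measure.map_conv_continuousLinearMap A)

theorem continuous_mapCLM (A : E →L[ℝ] F) : Continuous (mapCLM A) :=
  ProbabilityMeasure.continuous_map A.continuous

theorem continuous_uncurry_mapCLM [PolishSpace E] [TopologicalSpace X] [PolishSpace X]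
    {A : X → E →L[ℝ] F} (hA : Continuous fun p : X × E => A p.1 p.2) :
    Continuous fun p : X × ProbabilityMeasure E => mapCLM (A p.1) p.2 := by
  borelize X
  have hprod : Continuous fun p : X × ProbabilityMeasure E =>
      ((pointMass p.1).prod p.2).map hA.measurable.aemeasurable :=
    (ProbabilityMeasure.continuous_map hA).comp (ProbabilityMeasure.continuous_prod.comp
      ((continuous_pointMass.comp continuous_fst).prodMk continuous_snd))
  refine hprod.congr fun p => Subtype.ext ?_
  change ((Measure.dirac p.1).prod (p.2 : Measure E)).map (fun q => A q.1 q.2) = _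
  rw [Measure.dirac_prod, Measure.map_map hA.measurable measurable_prodMk_left]
  rfl

theorem tendsto_mapCLM [PolishSpace E] [TopologicalSpace X] [PolishSpace X]
    {A : X → E →L[ℝ] F} (hA : Continuous fun p : X × E => A p.1 p.2) {ι : Type*} {l : Filter ι}
    {s : ι → X} {c : X} {a : ι → ProbabilityMeasure E} {α : ProbabilityMeasure E}
    (hs : Tendsto s l (𝓝 c)) (ha : Tendsto a l (𝓝 α)) :
    Tendsto (fun i => mapCLM (A (s i)) (a i)) l (𝓝 (mapCLM (A c) α)) :=
  ((continuous_uncurry_mapCLM hA).tendsto (c, α)).comp (hs.prodMk_nhds ha)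

end MapCLM

section Symmetrization

variable {E : Type*} [AddCommGroup E] [Module ℝ E] [TopologicalSpace E]
  [IsTopologicalAddGroup E] [PolishSpace E] [MeasurableSpace E] [BorelSpace E]

/-- The symmetrization of `μ`: the law of `X - Y` for independent `X` and `Y` with law `μ`.
It is unaffected by translations of `μ`. -/
noncomputable def symmetrize (μ : ProbabilityMeasure E) : ProbabilityMeasure E :=
  conv μ (mapCLM (-1) μ)

theorem continuous_symmetrize : Continuous (symmetrize (E := E)) :=
  continuous_conv.comp (continuous_id.prodMk (continuous_mapCLM _))

theorem symmetrize_conv (μ ν : ProbabilityMeasure E) :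
    symmetrize (conv μ ν) = conv (symmetrize μ) (symmetrize ν) := by
  simp only [symmetrize, mapCLM_conv]
  ac_rfl

@[simp]
theorem symmetrize_pointMass (x : E) : symmetrize (pointMass x) = pointMass 0 := by
  rw [symmetrize, mapCLM_pointMass, pointMass_conv_pointMass, neg_apply, one_apply_eq_self,
    add_neg_cancel]

theorem symmetrize_conv_pointMass (μ : ProbabilityMeasure E) (x : E) :
    symmetrize (conv μ (pointMass x)) = symmetrize μ := by
  rw [symmetrize_conv, symmetrize_pointMass, conv_pointMass_zero]

theorem symmetrize_mapCLM (A : E →L[ℝ] E) (μ : ProbabilityMeasure E) :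
    symmetrize (mapCLM A μ) = mapCLM A (symmetrize μ) := by
  rw [symmetrize, symmetrize, mapCLM_conv, ← mapCLM_mul, ← mapCLM_mul, neg_one_mul, mul_neg_one]

theorem convProd_symmetrize (m : ℕ → ProbabilityMeasure E) (n : ℕ) :
    convProd (fun i => symmetrize (m i)) n = symmetrize (convProd m n) := by
  induction n with
  | zero => exact (symmetrize_pointMass 0).symm
  | succ n ih => rw [convProd, convProd, ih, symmetrize_conv]

end Symmetrization

section Tightness

theorem isTightMeasureSet_range_of_tendsto {X : Type*} [TopologicalSpace X] [PolishSpace X]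
    [MeasurableSpace X] [BorelSpace X] {a : ℕ → ProbabilityMeasure X} {α : ProbabilityMeasure X}
    (ha : Tendsto a atTop (𝓝 α)) : IsTightMeasureSet (range fun n => (a n : Measure X)) := by
  let _ := TopologicalSpace.upgradeIsCompletelyMetrizable X
  have hcompact : IsCompact (closure (range a)) :=
    ha.isCompact_insert_range.closure_of_subset (subset_insert _ _)
  refine (isTightMeasureSet_of_isCompact_closure hcompact).subset ?_
  rintro _ ⟨n, rfl⟩
  exact ⟨a n, mem_range_self n, rfl⟩

variable {E : Type*} [AddCommGroup E] [TopologicalSpace E]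
  [IsTopologicalAddGroup E] [PolishSpace E] [MeasurableSpace E] [BorelSpace E]

/- The law of `(X, X + Y)`, with `X` and `Y` independent of laws `a i` and `b i`, has tight
marginals, and `Y` is a continuous function of that pair. -/
theorem isTightMeasureSet_range_of_conv {ι : Type*} {a b : ι → ProbabilityMeasure E}
    (ha : IsTightMeasureSet (range fun i => (a i : Measure E)))
    (hab : IsTightMeasureSet (range fun i => (conv (a i) (b i) : Measure E))) :
    IsTightMeasureSet (range fun i => (b i : Measure E)) := by
  let shear : E × E → E × E := fun p => (p.1, p.1 + p.2)
  have hshear : Measurable shear := (by fun_prop : Continuous shear).measurable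
  let joint (i : ι) : Measure (E × E) := ((a i : Measure E).prod (b i : Measure E)).map shear
  have hfst (i : ι) : (joint i).fst = a i :=
    (Measure.map_map measurable_fst hshear).trans Measure.fst_prod
  have hsnd (i : ι) : (joint i).snd = conv (a i) (b i) := Measure.map_map measurable_snd hshear
  have hjoint : IsTightMeasureSet (range joint) :=
    .prodMk (by simpa only [← range_comp, Function.comp_def, hfst] using ha)
      (by simpa only [← range_comp, Function.comp_def, hsnd] using hab)
  have hdiff : Continuous fun p : E × E => p.2 - p.1 := by fun_prop
  have hdiff_shear : (fun p : E × E => p.2 - p.1) ∘ shear = Prod.snd :=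
    funext fun p => add_sub_cancel_left p.1 p.2
  have hb (i : ι) : (joint i).map (fun p => p.2 - p.1) = b i := by
    rw [Measure.map_map hdiff.measurable hshear, hdiff_shear]
    exact Measure.snd_prod
  simpa only [← range_comp, Function.comp_def, hb] using hjoint.map hdiff

theorem exists_strictMono_tendsto_of_tendsto_conv {a b : ℕ → ProbabilityMeasure E}
    {α γ : ProbabilityMeasure E} (ha : Tendsto a atTop (𝓝 α))
    (hab : Tendsto (fun n => conv (a n) (b n)) atTop (𝓝 γ)) :
    ∃ (φ : ℕ → ℕ) (β : ProbabilityMeasure E), StrictMono φ ∧ Tendsto (b ∘ φ) atTop (𝓝 β) ∧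
      conv α β = γ := by
  have hb : IsTightMeasureSet {β | ∃ ρ ∈ range b, (ρ : Measure E) = β} := by
    simpa only [exists_range_iff] using! isTightMeasureSet_range_of_conv
      (isTightMeasureSet_range_of_tendsto ha) (isTightMeasureSet_range_of_tendsto hab)
  obtain ⟨β, -, φ, hφ, hβ⟩ := (isCompact_closure_of_isTightMeasureSet hb).tendsto_subseq
    fun n => subset_closure (mem_range_self n)
  exact ⟨φ, β, hφ, hβ, tendsto_nhds_unique (tendsto_conv (ha.comp hφ.tendsto_atTop) hβ)
    (hab.comp hφ.tendsto_atTop)⟩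

end Tightness

section Factors

variable {E : Type*} [AddCommGroup E] [TopologicalSpace E]
  [IsTopologicalAddGroup E] [PolishSpace E] [MeasurableSpace E] [BorelSpace E]

/-- `α` divides `γ` in the convolution semigroup of probability measures. -/
def IsFactor (α γ : ProbabilityMeasure E) : Prop :=
  ∃ β, conv α β = γ

theorem isFactor_conv (α β : ProbabilityMeasure E) : IsFactor α (conv α β) := ⟨β, rfl⟩

theorem isFactor_pointMass (x : E) (γ : ProbabilityMeasure E) : IsFactor (pointMass x) γ :=
  ⟨conv (pointMass (-x)) γ, by
    rw [← conv_assoc, pointMass_conv_pointMass, add_neg_cancel, pointMass_zero_conv]⟩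

theorem IsFactor.trans {α β γ : ProbabilityMeasure E} (hαβ : IsFactor α β)
    (hβγ : IsFactor β γ) : IsFactor α γ := by
  obtain ⟨ρ, rfl⟩ := hαβ
  obtain ⟨σ, rfl⟩ := hβγ
  exact ⟨conv ρ σ, (conv_assoc α ρ σ).symm⟩

theorem IsFactor.conv_pointMass {α γ : ProbabilityMeasure E} (h : IsFactor α γ) (x y : E) :
    IsFactor (conv α (pointMass x)) (conv γ (pointMass y)) := by
  obtain ⟨β, rfl⟩ := h
  have hy : pointMass y = conv (pointMass x) (pointMass (y - x)) := by
    rw [pointMass_conv_pointMass, add_sub_cancel]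
  exact ⟨conv β (pointMass (y - x)), by rw [hy]; ac_rfl⟩

theorem IsFactor.mapCLM [Module ℝ E] {α γ : ProbabilityMeasure E} (h : IsFactor α γ)
    (A : E →L[ℝ] E) : IsFactor (mapCLM A α) (mapCLM A γ) := by
  obtain ⟨β, rfl⟩ := h
  exact ⟨_, (mapCLM_conv A α β).symm⟩

theorem isFactor_of_tendsto {a g : ℕ → ProbabilityMeasure E} {α γ : ProbabilityMeasure E}
    (h : ∀ n, IsFactor (a n) (g n)) (ha : Tendsto a atTop (𝓝 α)) (hg : Tendsto g atTop (𝓝 γ)) :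
    IsFactor α γ := by
  choose b hb using h
  obtain ⟨-, β, -, -, hβ⟩ :=
    exists_strictMono_tendsto_of_tendsto_conv ha (hg.congr fun n => (hb n).symm)
  exact ⟨β, hβ⟩

theorem isFactor_convProd (m : ℕ → ProbabilityMeasure E) {n N : ℕ} (h : n ≤ N) :
    IsFactor (convProd m n) (convProd m N) := by
  induction N, h using Nat.le_induction with
  | base => exact ⟨pointMass 0, conv_pointMass_zero _⟩
  | succ N _ ih => exact ih.trans (isFactor_conv _ _)

end Factors

section SelfCofactor

variable {E : Type*} [AddCommGroup E] [TopologicalSpace E]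
  [IsTopologicalAddGroup E] [PolishSpace E] [MeasurableSpace E] [BorelSpace E]
  {μ ν : ProbabilityMeasure E}

/- Choquet–Deny: `∬ (g (x + y) - g x)² dν(y) dμ(x)` expands to `∫ g² d(μ * ν) - ∫ g² dμ = 0`. -/
theorem apply_add_eq_of_mem_support (h : conv μ ν = μ) {g : E →ᵇ ℝ}
    (hg : ∀ x, ∫ y, g (x + y) ∂(ν : Measure E) = g x) {x y : E}
    (hx : x ∈ (μ : Measure E).support) (hy : y ∈ (ν : Measure E).support) :
    g (x + y) = g x := by
  let P : Measure (E × E) := (μ : Measure E).prod ν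
  let u : E × E →ᵇ ℝ := g.compContinuous ⟨fun p => p.1 + p.2, continuous_add⟩
  let v : E × E →ᵇ ℝ := g.compContinuous ⟨Prod.fst, continuous_fst⟩
  have hu : ∫ p, (u * u) p ∂P = ∫ x, (g * g) x ∂(μ : Measure E) := by
    conv_rhs => rw [← h]
    exact (integral_map measurable_add.aemeasurable
      (g * g).continuous.aestronglyMeasurable).symm
  have hv : ∫ p, (v * v) p ∂P = ∫ x, (g * g) x ∂(μ : Measure E) := by
    simpa using! integral_fun_fst (μ := (μ : Measure E)) (ν := (ν : Measure E)) (g * g)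
  have huv : ∫ p, (v * u) p ∂P = ∫ x, (g * g) x ∂(μ : Measure E) := by
    rw [integral_prod _ ((v * u).integrable P)]
    refine integral_congr_ae (.of_forall fun x => ?_)
    exact (integral_const_mul (g x) fun y => g (x + y)).trans (congrArg (g x * ·) (hg x))
  have hzero : ∫ p, ((u - v) * (u - v)) p ∂P = 0 := by
    have hexpand : (u - v) * (u - v) = u * u - v * u - v * u + v * v := by ring
    have hadd (a b : E × E →ᵇ ℝ) : ∫ p, (a + b) p ∂P = ∫ p, a p ∂P + ∫ p, b p ∂P :=
      integral_add (a.integrable P) (b.integrable P)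
    have hsub (a b : E × E →ᵇ ℝ) : ∫ p, (a - b) p ∂P = ∫ p, a p ∂P - ∫ p, b p ∂P :=
      integral_sub (a.integrable P) (b.integrable P)
    rw [hexpand, hadd, hsub, hsub, hu, hv, huv]
    ring
  have hae : ∀ᵐ p ∂P, g (p.1 + p.2) = g p.1 := by
    have hsq := (integral_eq_zero_iff_of_nonneg (fun p => mul_self_nonneg ((u - v) p))
      (((u - v) * (u - v)).integrable P)).1 hzero
    filter_upwards [hsq] with p hp using sub_eq_zero.1 (mul_self_eq_zero.1 hp)
  have hsupp : ∀ᵐ x ∂(μ : Measure E), ∀ y ∈ (ν : Measure E).support, g (x + y) = g x := by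
    filter_upwards [Measure.ae_ae_of_ae_prod hae] with x hx
    exact Measure.support_subset_of_isClosed
      (isClosed_eq (by fun_prop) continuous_const) hx
  have hclosed : IsClosed {x | ∀ y ∈ (ν : Measure E).support, g (x + y) = g x} := by
    simp only [ofPred_forall]
    exact isClosed_biInter fun y _ => isClosed_eq (by fun_prop) g.continuous
  exact Measure.support_subset_of_isClosed hclosed hsupp hx y hy

theorem conv_pointMass_eq_self_of_mem_support (h : conv μ ν = μ) {y : E}
    (hy : y ∈ (ν : Measure E).support) : conv μ (pointMass y) = μ := by
  refine ProbabilityMeasure.toMeasure_injective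
    (ext_of_forall_integral_eq_of_IsFiniteMeasure fun f => ?_)
  obtain ⟨x₀, hx₀⟩ : (μ : Measure E).support.Nonempty :=
    Measure.nonempty_support (IsProbabilityMeasure.ne_zero _)
  let shift (x : E) : E →ᵇ ℝ := f.compContinuous ⟨(x + ·), continuous_const_add x⟩
  let g : E →ᵇ ℝ := .ofNormedAddCommGroup (fun x => ∫ z, shift (x - x₀) z ∂(μ : Measure E))
    (continuous_of_dominated (bound := fun _ => ‖f‖)
      (fun x => (shift _).continuous.aestronglyMeasurable)
      (fun x => .of_forall fun z => f.norm_coe_le_norm _) (integrable_const _)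
      (.of_forall fun z => f.continuous.comp (show Continuous fun x => x - x₀ + z by fun_prop)))
    ‖f‖ fun x => (norm_integral_le_of_norm_le_const
      (.of_forall fun z => f.norm_coe_le_norm _)).trans_eq (by simp)
  have hνμ : (ν : Measure E).conv μ = μ := congrArg Subtype.val ((conv_comm ν μ).trans h)
  have hg (x : E) : ∫ y, g (x + y) ∂(ν : Measure E) = g x := by
    have hconv := integral_conv ((shift (x - x₀)).integrable ((ν : Measure E).conv μ))
    rw [hνμ] at hconv
    refine Eq.trans ?_ hconv.symm
    exact integral_congr_ae (.of_forall fun y => integral_congr_ae (.of_forall fun z =>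
      congrArg f (show x + y - x₀ + z = x - x₀ + (y + z) by abel)))
  calc
    ∫ z, f z ∂(conv μ (pointMass y) : Measure E) = ∫ z, f (y + z) ∂(μ : Measure E) := by
      rw [conv_comm]
      refine (integral_conv (f.integrable ((Measure.dirac y).conv (μ : Measure E)))).trans ?_
      exact integral_dirac (fun y => ∫ z, f (y + z) ∂(μ : Measure E)) y
    _ = g (x₀ + y) := by simp [g, shift]
    _ = g x₀ := apply_add_eq_of_mem_support h hg hx₀ hy
    _ = ∫ z, f z ∂(μ : Measure E) := by simp [g, shift]

theorem eq_zero_of_conv_pointMass_eq_self [Module ℝ E] [ContinuousSMul ℝ E] {y : E}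
    (h : conv μ (pointMass y) = μ) : y = 0 := by
  have hmul (n : ℕ) : conv μ (pointMass ((n : ℝ) • y)) = μ := by
    induction n with
    | zero => simp
    | succ n ih =>
      rw [Nat.cast_succ, add_smul, one_smul, ← pointMass_conv_pointMass, ← conv_assoc, ih, h]
  obtain ⟨φ, β, hφ, hβ, -⟩ := exists_strictMono_tendsto_of_tendsto_conv
    (tendsto_const_nhds (x := μ)) (tendsto_const_nhds.congr fun n => (hmul n).symm)
  have hscale : Tendsto (fun n => mapCLM ((φ n : ℝ)⁻¹ • (1 : E →L[ℝ] E))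
      (pointMass ((φ n : ℝ) • y))) atTop (𝓝 (mapCLM ((0 : ℝ) • 1) β)) :=
    tendsto_mapCLM (A := fun t : ℝ => t • (1 : E →L[ℝ] E)) continuous_smul
      (tendsto_inv_atTop_nhds_zero_nat.comp hφ.tendsto_atTop) hβ
  rw [zero_smul, mapCLM_zero] at hscale
  refine pointMass_injective (tendsto_nhds_unique (tendsto_const_nhds.congr' ?_) hscale)
  filter_upwards [hφ.tendsto_atTop.eventually_gt_atTop 0] with n hn
  have hn' : (φ n : ℝ) ≠ 0 := Nat.cast_ne_zero.2 hn.ne'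
  rw [mapCLM_pointMass, smul_apply, one_apply_eq_self, inv_smul_smul₀ hn']

theorem eq_pointMass_zero_of_conv_eq_self [Module ℝ E] [ContinuousSMul ℝ E]
    (h : conv μ ν = μ) : ν = pointMass 0 := by
  refine eq_pointMass_of_ae_eq ?_
  filter_upwards [Measure.support_mem_ae] with y hy
  exact eq_zero_of_conv_pointMass_eq_self (conv_pointMass_eq_self_of_mem_support h hy)

end SelfCofactor

section Infinitesimal

variable {E : Type*} [AddCommGroup E] [TopologicalSpace E] [MeasurableSpace E]
  {k : ℕ → ℕ} {lam : ℕ → ℕ → ProbabilityMeasure E}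

theorem Infinitesimal.comp (h : Infinitesimal k lam) {φ : ℕ → ℕ} (hφ : Tendsto φ atTop atTop) :
    Infinitesimal (fun n => k (φ n)) fun n => lam (φ n) :=
  fun U hU h0 => (h U hU h0).comp hφ

variable [PolishSpace E] [BorelSpace E]

theorem Infinitesimal.tendsto (h : Infinitesimal k lam) {i : ℕ → ℕ}
    (hi : ∀ᶠ n in atTop, i n < k n) : Tendsto (fun n => lam n (i n)) atTop (𝓝 (pointMass 0)) := by
  refine tendsto_pointMass_iff.2 fun U hU h0 => ?_
  refine tendsto_of_tendsto_of_tendsto_of_le_of_le' tendsto_const_nhds (h U hU h0)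
    (.of_forall fun _ => zero_le) ?_
  filter_upwards [hi] with n hn
  exact le_iSup₂ (f := fun j (_ : j ∈ Finset.range (k n)) => (lam n j : Measure E) Uᶜ) (i n)
    (Finset.mem_range.2 hn)

theorem infinitesimal_mapCLM [Module ℝ E] {A : ℕ → ℕ → E →L[ℝ] E}
    (hA : ∀ U ∈ 𝓝 (0 : E), ∃ V ∈ 𝓝 (0 : E), ∀ n, ∀ i < k n, MapsTo (A n i) V U)
    {ν : ℕ → ProbabilityMeasure E} (hν : Tendsto ν atTop (𝓝 (pointMass 0)))
    (hAν : ∀ i, Tendsto (fun n => mapCLM (A n i) (ν i)) atTop (𝓝 (pointMass 0))) :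
    Infinitesimal k fun n i => mapCLM (A n i) (ν i) := by
  intro U hU h0
  obtain ⟨V, hV, hVU⟩ := hA U (hU.mem_nhds h0)
  obtain ⟨W, hWV, hW, hW0⟩ := mem_nhds_iff.1 hV
  refine ENNReal.tendsto_nhds_zero.2 fun ε hε => ?_
  obtain ⟨N, hN⟩ := eventually_atTop.1
    (ENNReal.tendsto_nhds_zero.1 (tendsto_pointMass_iff.1 hν W hW hW0) ε hε)
  have hsmall : ∀ᶠ n in atTop, ∀ i < N, (mapCLM (A n i) (ν i) : Measure E) Uᶜ ≤ ε :=
    (finite_lt_nat N).eventually_all.2 fun i _ =>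
      ENNReal.tendsto_nhds_zero.1 (tendsto_pointMass_iff.1 (hAν i) U hU h0) ε hε
  filter_upwards [hsmall] with n hn
  refine iSup₂_le fun i hi => ?_
  rcases lt_or_ge i N with hiN | hiN
  · exact hn i hiN
  calc
    (mapCLM (A n i) (ν i) : Measure E) Uᶜ = (ν i : Measure E) (A n i ⁻¹' Uᶜ) :=
      Measure.map_apply (A n i).continuous.measurable hU.measurableSet.compl
    _ ≤ (ν i : Measure E) Wᶜ := measure_mono fun y hy hyW =>
      hy (hVU n i (Finset.mem_range.1 hi) (hWV hyW))
    _ ≤ ε := hN i hiN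

end Infinitesimal

section Normalizers

variable {E : Type*} [AddCommGroup E] [Module ℝ E] [TopologicalSpace E]
  [MeasurableSpace E] [BorelSpace E] {D : ℝ≥0 →*₀ (E →L[ℝ] E)}

theorem mapCLM_div_mapCLM_inv {s t : ℝ≥0} (hs : s ≠ 0) (μ : ProbabilityMeasure E) :
    mapCLM (D (s / t)) (mapCLM (D s⁻¹) μ) = mapCLM (D t⁻¹) μ := by
  rw [← mapCLM_mul, ← map_mul, div_mul_eq_mul_div, mul_inv_cancel₀ hs, one_div]

variable [PolishSpace E]

theorem eq_pointMass_zero_of_mapCLM_eq_self (hD : Continuous fun p : ℝ≥0 × E => D p.1 p.2)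
    {r : ℝ≥0} (hr : r < 1) {π : ProbabilityMeasure E} (h : mapCLM (D r) π = π) :
    π = pointMass 0 := by
  have hpow (n : ℕ) : mapCLM (D (r ^ n)) π = π := by
    induction n with
    | zero => rw [pow_zero, map_one, mapCLM_one]
    | succ n ih => rw [pow_succ, map_mul, mapCLM_mul, h, ih]
  have hlim := tendsto_mapCLM hD (tendsto_pow_atTop_nhds_zero_of_lt_one zero_le hr)
    (tendsto_const_nhds (x := π))
  rw [map_zero, mapCLM_zero] at hlim
  exact tendsto_nhds_unique (tendsto_const_nhds.congr fun n => (hpow n).symm) hlim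

variable [IsTopologicalAddGroup E]

theorem tendsto_one_of_le_one_of_mapCLM_conv_eq (hD : Continuous fun p : ℝ≥0 × E => D p.1 p.2)
    {ι : Type*} {l : Filter ι} {p q e f : ι → ProbabilityMeasure E} {s : ι → ℝ≥0}
    {π : ProbabilityMeasure E} (hp : Tendsto p l (𝓝 π)) (hq : Tendsto q l (𝓝 π))
    (he : Tendsto e l (𝓝 (pointMass 0))) (hf : Tendsto f l (𝓝 (pointMass 0)))
    (hπ : π ≠ pointMass 0) (hs : ∀ᶠ i in l, s i ≤ 1)
    (h : ∀ᶠ i in l, conv (mapCLM (D (s i)) (p i)) (e i) = conv (q i) (mapCLM (D (s i)) (f i))) :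
    Tendsto s l (𝓝 1) := by
  refine (isCompact_Icc (a := 0) (b := 1)).tendsto_nhds_of_unique_mapClusterPt
    (hs.mono fun i hi => ⟨zero_le, hi⟩) fun r hr hrs => ?_
  obtain ⟨g, hg, hgr⟩ := mapClusterPt_iff_ultrafilter.1 hrs
  have hleft := tendsto_conv (tendsto_mapCLM hD hgr (hp.mono_left hg)) (he.mono_left hg)
  have hright := tendsto_conv (hq.mono_left hg) (tendsto_mapCLM hD hgr (hf.mono_left hg))
  have hfix := tendsto_nhds_unique_of_eventuallyEq hleft hright (hg h)
  rw [mapCLM_pointMass, map_zero, conv_pointMass_zero, conv_pointMass_zero] at hfix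
  exact hr.2.eq_of_not_lt fun hr1 => hπ (eq_pointMass_zero_of_mapCLM_eq_self hD hr1 hfix)

theorem tendsto_one_of_mapCLM_conv_eq (hD : Continuous fun p : ℝ≥0 × E => D p.1 p.2)
    {ι : Type*} {l : Filter ι} {p q e : ι → ProbabilityMeasure E} {s : ι → ℝ≥0}
    {π : ProbabilityMeasure E} (hp : Tendsto p l (𝓝 π)) (hq : Tendsto q l (𝓝 π))
    (he : Tendsto e l (𝓝 (pointMass 0))) (hπ : π ≠ pointMass 0) (hs : ∀ i, s i ≠ 0)
    (h : ∀ i, conv (mapCLM (D (s i)) (p i)) (e i) = q i) : Tendsto s l (𝓝 1) := by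
  have hle : Tendsto s (l ⊓ 𝓟 {i | s i ≤ 1}) (𝓝 1) :=
    tendsto_one_of_le_one_of_mapCLM_conv_eq hD (hp.mono_left inf_le_left)
      (hq.mono_left inf_le_left) (he.mono_left inf_le_left)
      (tendsto_const_nhds (x := pointMass 0)) hπ (mem_inf_of_right (mem_principal_self _))
      (.of_forall fun i => by rw [h, mapCLM_pointMass, map_zero, conv_pointMass_zero])
  have hgt : Tendsto (fun i => (s i)⁻¹) (l ⊓ 𝓟 {i | s i ≤ 1}ᶜ) (𝓝 1) := by
    refine tendsto_one_of_le_one_of_mapCLM_conv_eq hD (hq.mono_left inf_le_left)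
      (hp.mono_left inf_le_left) (tendsto_const_nhds (x := pointMass 0))
      (he.mono_left inf_le_left) hπ ?_ (.of_forall fun i => ?_)
    · filter_upwards [mem_inf_of_right (mem_principal_self _)] with i hi
      exact inv_le_one_of_one_le₀ (le_of_not_ge hi)
    · rw [conv_pointMass_zero, ← h, mapCLM_conv, ← mapCLM_mul, ← map_mul,
        inv_mul_cancel₀ (hs i), map_one, mapCLM_one]
  have hsup := hle.sup (by simpa using hgt.inv₀ one_ne_zero)
  rwa [← inf_sup_left, sup_principal, union_compl_self, principal_univ, inf_top_eq] at hsup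

end Normalizers

section Ratios

variable {K : Type*} [Semifield K] [LinearOrder K] [IsStrictOrderedRing K] [TopologicalSpace K]
  [OrderTopology K] [ContinuousMul K] {b : ℕ → K}

theorem exists_tendsto_div_of_tendsto_div_succ (hb : ∀ n, 0 < b n) (hb_top : Tendsto b atTop atTop)
    (hb_div : Tendsto (fun n => b n / b (n + 1)) atTop (𝓝 1)) {c : K} (hc0 : 0 < c) (hc1 : c < 1) :
    ∃ N : ℕ → ℕ, (∀ n, N n ≤ n) ∧ Tendsto N atTop atTop ∧
      Tendsto (fun n => b (N n) / b n) atTop (𝓝 c) := by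
  let N (n : ℕ) : ℕ := Nat.findGreatest (fun k => b k ≤ c * b n) n
  have hle (j : ℕ) : ∀ᶠ n in atTop, b j ≤ c * b n :=
    (hb_top.const_mul_atTop hc0).eventually_ge_atTop (b j)
  have hN : Tendsto N atTop atTop := by
    refine tendsto_atTop.2 fun j => ?_
    filter_upwards [hle j, eventually_ge_atTop j] with n hn hj using Nat.le_findGreatest hj hn
  have hspec : ∀ᶠ n in atTop, b (N n) ≤ c * b n := by
    filter_upwards [hle 0] with n hn
    exact Nat.findGreatest_spec (P := fun k => b k ≤ c * b n) (Nat.zero_le n) hn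
  have hlower : Tendsto (fun n => c * (b (N n) / b (N n + 1))) atTop (𝓝 c) := by
    simpa using (hb_div.comp hN).const_mul c
  refine ⟨N, fun n => Nat.findGreatest_le n, hN,
    tendsto_of_tendsto_of_tendsto_of_le_of_le' hlower tendsto_const_nhds ?_ ?_⟩
  · filter_upwards [hspec] with n hn
    have hlt : N n < n := by
      refine lt_of_le_of_ne (Nat.findGreatest_le n) fun h => hn.not_gt ?_
      rw [h]
      exact mul_lt_of_lt_one_left (hb n) hc1
    have hgt : c * b n < b (N n + 1) := not_le.1
      (Nat.findGreatest_is_greatest (P := fun k => b k ≤ c * b n) (Nat.lt_succ_self _) hlt)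
    have hcb : c * b (N n) / b (N n + 1) ≤ c * b (N n) / (c * b n) :=
      div_le_div_of_nonneg_left (mul_pos hc0 (hb (N n))).le (mul_pos hc0 (hb n)) hgt.le
    rwa [mul_div_mul_left _ _ hc0.ne', mul_div_assoc] at hcb
  · filter_upwards [hspec] with n hn using (div_le_iff₀ (hb n)).2 hn

theorem exists_strictMono_tendsto_div_succ {b : ℝ} (hb0 : 0 < b) (hb1 : b < 1) :
    ∃ k : ℕ → ℕ, StrictMono k ∧
      Tendsto (fun n => ((k n : ℝ) + 1) / ((k (n + 1) : ℝ) + 1)) atTop (𝓝 b) := by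
  have hb : 1 < b⁻¹ := (one_lt_inv₀ hb0).2 hb1
  let k (n : ℕ) : ℕ := ⌊b⁻¹ ^ n⌋₊ + n
  have hk : StrictMono k := strictMono_nat_of_lt_succ fun n =>
    add_lt_add_of_le_of_lt (Nat.floor_mono (pow_le_pow_right₀ hb.le n.le_succ)) n.lt_succ_self
  have hk_asymp : Tendsto (fun n => ((k n : ℝ) + 1) / b⁻¹ ^ n) atTop (𝓝 1) := by
    have hpow := tendsto_pow_atTop_atTop_of_one_lt hb
    have hfloor := (tendsto_nat_floor_div_atTop (R := ℝ)).comp hpow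
    have hlin : Tendsto (fun n : ℕ => (n : ℝ) / b⁻¹ ^ n) atTop (𝓝 0) := by
      simpa only [pow_one] using tendsto_pow_const_div_const_pow_of_one_lt 1 hb
    have hone := (tendsto_const_nhds (x := (1 : ℝ))).div_atTop hpow
    have hsum := (hfloor.add hlin).add hone
    rw [add_zero, add_zero] at hsum
    refine hsum.congr fun n => ?_
    simp only [k, Function.comp_apply, Nat.cast_add, add_div]
  refine ⟨k, hk, ?_⟩
  have hquot := (hk_asymp.div (hk_asymp.comp (tendsto_add_atTop_nat 1)) one_ne_zero).const_mul b
  rw [div_one, mul_one] at hquot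
  refine hquot.congr fun n => ?_
  have hkn : (k (n + 1) : ℝ) + 1 ≠ 0 := by positivity
  simp only [Pi.div_apply, Function.comp_apply, pow_succ]
  field_simp

end Ratios

section Necessity

variable {E : Type*} [AddCommGroup E] [Module ℝ E] [TopologicalSpace E]
  [IsTopologicalAddGroup E] [PolishSpace E] [MeasurableSpace E] [BorelSpace E]
  {D : ℝ≥0 →*₀ (E →L[ℝ] E)} {m : ℕ → ProbabilityMeasure E} {b : ℕ → ℝ≥0}

theorem tendsto_normalizer_atTop (hD : Continuous fun p : ℝ≥0 × E => D p.1 p.2)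
    (hb : ∀ n, b n ≠ 0)
    (hm : ∀ i, Tendsto (fun n => mapCLM (D (b n)⁻¹) (m i)) atTop (𝓝 (pointMass 0)))
    {π : ProbabilityMeasure E} (hπ : π ≠ pointMass 0)
    (hlim : Tendsto (fun n => mapCLM (D (b n)⁻¹) (convProd m n)) atTop (𝓝 π)) :
    Tendsto b atTop atTop := by
  by_contra hnot
  obtain ⟨R, hR⟩ : ∃ R, ∃ᶠ n in atTop, b n ∈ Icc 0 R := by
    simp only [tendsto_atTop, not_forall, not_eventually] at hnot
    exact hnot.imp fun R hR => hR.mono fun n hn => ⟨zero_le, le_of_not_ge hn⟩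
  obtain ⟨β, -, hβ⟩ := isCompact_Icc.exists_mapClusterPt_of_frequently hR
  obtain ⟨g, hg, hgβ⟩ := mapClusterPt_iff_ultrafilter.1 hβ
  have hm_eq (i : ℕ) : m i = pointMass 0 := by
    have hlim_i := tendsto_mapCLM hD hgβ ((hm i).mono_left hg)
    rw [mapCLM_pointMass, map_zero] at hlim_i
    refine tendsto_nhds_unique (tendsto_const_nhds.congr fun n => ?_) hlim_i
    rw [← mapCLM_mul, ← map_mul, mul_inv_cancel₀ (hb n), map_one, mapCLM_one]
  obtain rfl : m = fun _ => pointMass 0 := funext hm_eq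
  refine hπ (tendsto_nhds_unique hlim (tendsto_const_nhds.congr fun n => ?_))
  rw [convProd_pointMass_zero, mapCLM_pointMass, map_zero]

theorem tendsto_normalizer_div_succ (hD : Continuous fun p : ℝ≥0 × E => D p.1 p.2)
    (hb : ∀ n, b n ≠ 0)
    (hm : Tendsto (fun n => mapCLM (D (b (n + 1))⁻¹) (m n)) atTop (𝓝 (pointMass 0)))
    {π : ProbabilityMeasure E} (hπ : π ≠ pointMass 0)
    (hlim : Tendsto (fun n => mapCLM (D (b n)⁻¹) (convProd m n)) atTop (𝓝 π)) :
    Tendsto (fun n => b n / b (n + 1)) atTop (𝓝 1) := by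
  refine tendsto_one_of_mapCLM_conv_eq hD hlim (hlim.comp (tendsto_add_atTop_nat 1)) hm hπ
    (fun n => div_ne_zero (hb n) (hb (n + 1))) fun n => ?_
  rw [mapCLM_div_mapCLM_inv (hb n), ← mapCLM_conv]
  rfl

theorem isFactor_mapCLM_of_tendsto_div (hD : Continuous fun p : ℝ≥0 × E => D p.1 p.2)
    {N M : ℕ → ℕ} (hNM : ∀ n, N n ≤ M n) {u v : ℕ → ℝ≥0} (hu : ∀ n, u n ≠ 0) {x y : ℕ → E}
    {μ : ProbabilityMeasure E}
    (hN : Tendsto (fun n => conv (mapCLM (D (u n)⁻¹) (convProd m (N n))) (pointMass (x n)))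
      atTop (𝓝 μ))
    (hM : Tendsto (fun n => conv (mapCLM (D (v n)⁻¹) (convProd m (M n))) (pointMass (y n)))
      atTop (𝓝 μ))
    {c : ℝ≥0} (hc : Tendsto (fun n => u n / v n) atTop (𝓝 c)) :
    IsFactor (mapCLM (D c) μ) μ := by
  refine isFactor_of_tendsto (fun n => ?_) (tendsto_mapCLM hD hc hN) hM
  rw [mapCLM_conv, mapCLM_div_mapCLM_inv (hu n), mapCLM_pointMass]
  exact ((isFactor_convProd m (hNM n)).mapCLM _).conv_pointMass _ _

/-- Selfdecomposability with respect to a family `D` of dilations, in its intrinsic form: every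
contraction of `μ` divides `μ`. -/
def IsSelfdecomposable (D : ℝ≥0 →*₀ (E →L[ℝ] E)) (μ : ProbabilityMeasure E) : Prop :=
  ∀ c < 1, IsFactor (mapCLM (D c) μ) μ

theorem isSelfdecomposable_pointMass (x : E) : IsSelfdecomposable D (pointMass x) := fun c _ => by
  rw [mapCLM_pointMass]
  exact isFactor_pointMass _ _

theorem isSelfdecomposable_of_infinitesimal (hD : Continuous fun p : ℝ≥0 × E => D p.1 p.2)
    (hb : ∀ n, b n ≠ 0) (hm : Infinitesimal (fun n => n) fun n i => mapCLM (D (b n)⁻¹) (m i))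
    {x : ℕ → E} {μ : ProbabilityMeasure E}
    (hlim : Tendsto (fun n => conv (mapCLM (D (b n)⁻¹) (convProd m n)) (pointMass (x n)))
      atTop (𝓝 μ)) : IsSelfdecomposable D μ := by
  by_cases hμ : symmetrize μ = pointMass 0
  · obtain ⟨z, rfl⟩ := exists_eq_pointMass_of_conv_eq_pointMass hμ
    exact isSelfdecomposable_pointMass z
  have hsymm_lim : Tendsto (fun n => mapCLM (D (b n)⁻¹) (convProd (fun i => symmetrize (m i)) n))
      atTop (𝓝 (symmetrize μ)) := by
    refine ((continuous_symmetrize.tendsto μ).comp hlim).congr fun n => ?_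
    rw [Function.comp_apply, symmetrize_conv_pointMass, symmetrize_mapCLM, convProd_symmetrize]
  have hsymm_row {i : ℕ → ℕ} (hi : ∀ᶠ n in atTop, i n < n) :
      Tendsto (fun n => mapCLM (D (b n)⁻¹) (symmetrize (m (i n)))) atTop (𝓝 (pointMass 0)) := by
    simpa only [Function.comp_def, symmetrize_mapCLM, symmetrize_pointMass] using
      (continuous_symmetrize.tendsto _).comp (hm.tendsto hi)
  have hsymm_last : Tendsto (fun n => mapCLM (D (b (n + 1))⁻¹) (symmetrize (m n))) atTop
      (𝓝 (pointMass 0)) :=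
    (hsymm_row (i := fun n => n - 1) ((eventually_gt_atTop 0).mono fun n hn => by lia)).comp
      (tendsto_add_atTop_nat 1)
  have hb_top : Tendsto b atTop atTop := tendsto_normalizer_atTop hD hb
    (fun i => hsymm_row (i := fun _ => i) (eventually_gt_atTop i)) hμ hsymm_lim
  have hb_div := tendsto_normalizer_div_succ hD hb hsymm_last hμ hsymm_lim
  intro c hc
  rcases eq_zero_or_pos c with rfl | hc0
  · rw [map_zero, mapCLM_zero]
    exact isFactor_pointMass 0 μ
  obtain ⟨N, hN, hN_top, hNc⟩ := exists_tendsto_div_of_tendsto_div_succ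
    (fun n => pos_iff_ne_zero.2 (hb n)) hb_top hb_div hc0 hc
  exact isFactor_mapCLM_of_tendsto_div hD hN (fun n => hb (N n)) (hlim.comp hN_top) hlim hNc

end Necessity

section Sufficiency

variable {E : Type*} [AddCommGroup E] [Module ℝ E] [TopologicalSpace E]
  [IsTopologicalAddGroup E] [PolishSpace E] [MeasurableSpace E] [BorelSpace E]
  {D : ℝ≥0 →*₀ (E →L[ℝ] E)} {μ : ProbabilityMeasure E}

theorem convProd_mapCLM_eq_mapCLM {ν : ℕ → ProbabilityMeasure E}
    (hν : ∀ n : ℕ, conv (mapCLM (D (n / (n + 1))) μ) (ν n) = μ) (n : ℕ) :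
    convProd (fun i => mapCLM (D (i + 1)) (ν i)) n = mapCLM (D n) μ := by
  induction n with
  | zero => rw [Nat.cast_zero, map_zero, mapCLM_zero, convProd]
  | succ n ih =>
    have hn : mapCLM (D n) μ = mapCLM (D (n + 1)) (mapCLM (D (n / (n + 1))) μ) := by
      rw [← mapCLM_mul, ← map_mul, mul_div_cancel₀ _ (by positivity)]
    rw [convProd, ih, hn, ← mapCLM_conv, hν, Nat.cast_succ]

variable [ContinuousSMul ℝ E]

theorem tendsto_pointMass_zero_of_conv_eq {a b : ℕ → ProbabilityMeasure E}
    (ha : Tendsto a atTop (𝓝 μ)) (hab : ∀ n, conv (a n) (b n) = μ) :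
    Tendsto b atTop (𝓝 (pointMass 0)) := by
  refine tendsto_of_subseq_tendsto fun φ hφ => ?_
  obtain ⟨ψ, β, -, hβ, hμβ⟩ := exists_strictMono_tendsto_of_tendsto_conv (ha.comp hφ)
    (tendsto_const_nhds.congr fun n => (hab (φ n)).symm)
  rw [eq_pointMass_zero_of_conv_eq_self hμβ] at hβ
  exact ⟨ψ, hβ⟩

theorem IsSelfdecomposable.exists_infinitesimal_tendsto (hD : ∀ x, Continuous fun t => D t x)
    (hμ : IsSelfdecomposable D μ) :
    ∃ m : ℕ → ProbabilityMeasure E,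
      Infinitesimal (fun n => n) (fun n i => mapCLM (D (n + 1 : ℝ≥0)⁻¹) (m i)) ∧
      Tendsto (fun n : ℕ => mapCLM (D (n + 1 : ℝ≥0)⁻¹) (convProd m n)) atTop (𝓝 μ) := by
  have hD' := continuous_uncurry_clm_of_continuous_apply hD
  choose ν hν using fun n : ℕ => hμ (n / (n + 1)) ((div_lt_one (by positivity)).2 (lt_add_one _))
  have hscale : Tendsto (fun n : ℕ => mapCLM (D (n / (n + 1))) μ) atTop (𝓝 μ) := by
    simpa using tendsto_mapCLM hD' (tendsto_natCast_div_add_atTop (1 : ℝ≥0))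
      (tendsto_const_nhds (x := μ))
  refine ⟨fun i => mapCLM (D (i + 1)) (ν i), ?_, ?_⟩
  · simp only [← mapCLM_mul, ← map_mul]
    refine infinitesimal_mapCLM (fun U hU => ?_)
      (tendsto_pointMass_zero_of_conv_eq hscale hν) fun i => ?_
    · obtain ⟨V, hV, hVU⟩ :=
        exists_nhds_zero_forall_mem_mapsTo_of_isCompact hD (isCompact_Icc (a := 0) (b := 1)) hU
      refine ⟨V, hV, fun n i hi => hVU _ ⟨zero_le, ?_⟩⟩
      rw [inv_mul_le_one₀ (by positivity)]
      gcongr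
    · have hinv : Tendsto (fun n : ℕ => (n + 1 : ℝ≥0)⁻¹) atTop (𝓝 0) := by
        simpa [Function.comp_def] using
          (tendsto_inv_atTop_nhds_zero_nat (𝕜 := ℝ≥0)).comp (tendsto_add_atTop_nat 1)
      have hrow : Tendsto (fun n : ℕ => (n + 1 : ℝ≥0)⁻¹ * (i + 1)) atTop (𝓝 0) := by
        simpa only [zero_mul] using hinv.mul_const (i + 1 : ℝ≥0)
      simpa using tendsto_mapCLM hD' hrow (tendsto_const_nhds (x := ν i))
  · refine hscale.congr fun n => ?_
    rw [convProd_mapCLM_eq_mapCLM hν, ← mapCLM_mul, ← map_mul, inv_mul_eq_div]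

end Sufficiency

section Classes

variable {E : Type*} [AddCommGroup E] [Module ℝ E] [TopologicalSpace E]
  [MeasurableSpace E] [BorelSpace E] {T : PosReal →* (E ≃L[ℝ] E)}

theorem opMap_inv_eq_mapCLM (s : PosReal) (μ : ProbabilityMeasure E) :
    opMap (T s⁻¹) μ = mapCLM (dilation T (s : ℝ).toNNReal⁻¹) μ := by
  have hpos : 0 < (s : ℝ).toNNReal⁻¹ := inv_pos.2 (Real.toNNReal_pos.2 s.2)
  have hs : s⁻¹ = ⟨(s : ℝ).toNNReal⁻¹, NNReal.coe_pos.2 hpos⟩ :=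
    Subtype.ext (congrArg (·⁻¹) (Real.coe_toNNReal s s.2.le).symm)
  rw [dilation_of_pos hpos, hs]
  rfl

variable [IsTopologicalAddGroup E] [ContinuousSMul ℝ E] [PolishSpace E] {μ : ProbabilityMeasure E}

theorem OperatorSelfdecomposable.isSelfdecomposable (hT : InLPlus T)
    (h : OperatorSelfdecomposable T μ) : IsSelfdecomposable (dilation T) μ := by
  obtain ⟨m, x, b, hm, hlim⟩ := h
  simp only [opMap_inv_eq_mapCLM] at hm hlim
  exact isSelfdecomposable_of_infinitesimal
    (continuous_uncurry_clm_of_continuous_apply hT.continuous_dilation)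
    (fun n => (Real.toNNReal_pos.2 (b n).2).ne') hm hlim

theorem isFactor_mapCLM_of_mem_KTilde (hT : InLPlus T)
    {H : Set (ProbabilityMeasure E)} {b : ℝ} (h : μ ∈ KTilde H b T) :
    IsFactor (mapCLM (dilation T b.toNNReal) μ) μ := by
  obtain ⟨m, a, k, x, -, hk, ha, hlim⟩ := h
  simp only [opMap_inv_eq_mapCLM] at hlim
  refine isFactor_mapCLM_of_tendsto_div
    (continuous_uncurry_clm_of_continuous_apply hT.continuous_dilation)
    (fun n => (hk n.lt_succ_self).le) (fun n => (Real.toNNReal_pos.2 (a n).2).ne') hlim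
    (hlim.comp (tendsto_add_atTop_nat 1)) ?_
  simpa only [Real.toNNReal_div (a _).2.le] using tendsto_real_toNNReal ha

theorem isSelfdecomposable_of_mem_L0TildeUnit (hT : InLPlus T)
    (h : μ ∈ L0TildeUnit T) : IsSelfdecomposable (dilation T) μ := by
  intro c hc
  rcases eq_zero_or_pos c with rfl | hc0
  · rw [map_zero, mapCLM_zero]
    exact isFactor_pointMass 0 μ
  · have hcμ := mem_iInter₂.1 h c (by rw [Icc_sdiff_both]; exact ⟨hc0, hc⟩)
    simpa only [Real.toNNReal_coe] using isFactor_mapCLM_of_mem_KTilde hT hcμ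

theorem IsSelfdecomposable.exists_infinitesimal_tendsto_opMap (hT : InLPlus T)
    (hμ : IsSelfdecomposable (dilation T) μ) :
    ∃ (m : ℕ → ProbabilityMeasure E) (a : ℕ → PosReal), (∀ n, (a n : ℝ) = n + 1) ∧
      Infinitesimal (fun n => n) (fun n i => opMap (T (a n)⁻¹) (m i)) ∧
      Tendsto (fun n => conv (opMap (T (a n)⁻¹) (convProd m n)) (pointMass 0)) atTop (𝓝 μ) := by
  obtain ⟨m, hm, hlim⟩ := hμ.exists_infinitesimal_tendsto hT.continuous_dilation
  have ha (n : ℕ) : (n + 1 : ℝ).toNNReal = n + 1 := by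
    rw [Real.toNNReal_add (by positivity) zero_le_one, Real.toNNReal_natCast, Real.toNNReal_one]
  refine ⟨m, fun n => ⟨n + 1, by positivity⟩, fun n => rfl, ?_, ?_⟩
  · simpa only [opMap_inv_eq_mapCLM, ha] using hm
  · simpa only [opMap_inv_eq_mapCLM, ha, conv_pointMass_zero] using hlim

theorem IsSelfdecomposable.operatorSelfdecomposable (hT : InLPlus T)
    (hμ : IsSelfdecomposable (dilation T) μ) : OperatorSelfdecomposable T μ := by
  obtain ⟨m, a, -, hm, hlim⟩ := hμ.exists_infinitesimal_tendsto_opMap hT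
  exact ⟨m, fun _ => 0, a, hm, hlim⟩

theorem IsSelfdecomposable.mem_L0 (hT : InLPlus T) (hμ : IsSelfdecomposable (dilation T) μ)
    {b : ℝ} (hb0 : 0 < b) (hb1 : b < 1) : μ ∈ L0 b T := by
  obtain ⟨m, a, ha, hm, hlim⟩ := hμ.exists_infinitesimal_tendsto_opMap hT
  obtain ⟨k, hk, hkb⟩ := exists_strictMono_tendsto_div_succ hb0 hb1
  exact ⟨m, a ∘ k, k, fun _ => 0, fun _ => mem_univ _, hk,
    by simpa only [Function.comp_apply, ha] using hkb, hlim.comp hk.tendsto_atTop,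
    hm.comp hk.tendsto_atTop⟩

end Classes

end OpSelfDec

theorem mainTheorem2_general {E : Type*} [AddCommGroup E] [Module ℝ E] [TopologicalSpace E]
    [IsTopologicalAddGroup E] [ContinuousSMul ℝ E] [PolishSpace E]
    [MeasurableSpace E] [BorelSpace E]
    (T : OpSelfDec.PosReal →* (E ≃L[ℝ] E)) (hT : OpSelfDec.InLPlus T)
    (μ : ProbabilityMeasure E) :
    List.TFAE [
      OpSelfDec.OperatorSelfdecomposable T μ,
      μ ∈ OpSelfDec.L0Unit T,
      μ ∈ OpSelfDec.L0TildeUnit T,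
      ∀ b : ℝ, 0 < b → b < 1 → μ ∈ OpSelfDec.L0 b T] := by
  tfae_have 1 → 4 := fun h b hb0 hb1 => (h.isSelfdecomposable hT).mem_L0 hT hb0 hb1
  tfae_have 4 → 2 := fun h => mem_iInter₂.2 fun b hb => by
    rw [Icc_sdiff_both] at hb
    exact h b hb.1 hb.2
  tfae_have 2 → 3 := fun h => mem_iInter₂.2 fun b hb => by
    obtain ⟨m, a, k, x, hm, hk, ha, hlim, -⟩ := mem_iInter₂.1 h b hb
    exact ⟨m, a, k, x, hm, hk, ha, hlim⟩
  tfae_have 3 → 1 := fun h =>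
    (OpSelfDec.isSelfdecomposable_of_mem_L0TildeUnit hT h).operatorSelfdecomposable hT
  tfae_finish

theorem mainTheorem2 {E : Type*} [AddCommGroup E] [Module ℝ E] [TopologicalSpace E]
    [IsTopologicalAddGroup E] [ContinuousSMul ℝ E] [PolishSpace E]
    [MeasurableSpace E] [BorelSpace E] [SeparatingDual ℝ E]
    (hE : OpSelfDec.StronglyRootCompact E)
    (T : OpSelfDec.PosReal →* (E ≃L[ℝ] E)) (hT : OpSelfDec.InLPlus T)
    (μ : ProbabilityMeasure E) :
    List.TFAE [
      OpSelfDec.OperatorSelfdecomposable T μ,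
      μ ∈ OpSelfDec.L0Unit T,
      μ ∈ OpSelfDec.L0TildeUnit T,
      ∀ b : ℝ, 0 < b → b < 1 → μ ∈ OpSelfDec.L0 b T] :=
  mainTheorem2_general T hT μ
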